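/- **Octahedron and lengths.** Let $\mathbb{G}_{\mathrm{oct}}$ be the graph with vertices $1,\dots,6$ in which all pairs are edges except $\{1,2\}$, $\{3,4\}$, $\{5,6\}$. Orient its edges as $(1,6),(1,3),(4,1),(5,1),(6,3),(4,6),(6,2),(3,5),(3,2),(5,4),(2,4),(2,5)$. Let $\lambda$ be a labeling of the edges by positive real numbers. Put $\ell_{ij}=\lambda_{\{i,j\}}$ and $\ell_{ji}=-\lambda_{\{i,j\}}$ if $(i,j)$ is one of the twelve oriented edges above. **Compatible realizations.** Let $S^2_{\mathbb{C}}=\{q\in\mathbb{C}^3: \langle q,q\rangle=1\}$, with $\langle\cdot,\cdot\rangle$ the standard bilinear form. A compatible spherical realization is a choice of a point $q_{\{i,j\}}\in S^2_{\mathbb{C}}$ for each of the $12$ edges such that, for each three pairwise adjacent vertices $i,j,m$, $$\langle q_{\{i,j\}},q_{\{m,j\}}\rangle=\frac{\lambda_{\{i,j\}}^2+\lambda_{\{m,j\}}^2-\lambda_{\{i,m\}}^2}{2\,\ell_{ij}\,\ell_{mj}}.$$ (If $\rho$ is a realization of the octahedron with edge lengths $\lambda$, then the vectors defined by $\rho(i)-\rho(j)=\ell_{ij}\,q_{\{i,j\}}$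 satisfy this.) **Marked points.** The two lines on $S^2_{\mathbb{C}}$ through a point $q$ have directions $n$ with $q\times n=\mathrm{i}\,n$ and $q\times n=-\mathrm{i}\,n$. Their points at infinity, on the conic $\{\langle n,n\rangle=0\}\cong\mathbb{P}^1_{\mathbb{C}}$, are the left and the right lift of $q$. For each of the twelve oriented edges $(i,j)$ let $P_{ij}$ be the left lift and $P_{ji}$ the right lift of $q_{\{i,j\}}$. A compatible spherical realization with $24$ distinct lifts thus gives a point of $\mathscr{M}_{0,24}$. The configuration space $C\subseteq\overline{\mathscr{M}}_{0,24}$ is the Zariski closure of the set of all these points. A motion is an irreducible component of $C$ that meets $\mathscr{M}_{0,24}$. **Octahedral bonds.** Let $\{m,n\}$ be one of the three non-edges, and let $(t_1,s_1),\dots,(t_4,s_4)$ be the four edges of the quadrilateral induced by the other four vertices, each with an arbitrary orientation. Put $$I=\{P_{m\ast},P_{\ast m},P_{t_1s_1},\dots,P_{t_4s_4}\},\qquad J=\{P_{n\ast},P_{\ast n},P_{s_1t_1},\dots,P_{s_4t_4}\},$$ where $\ast$ ranges over the four vertices other than $m,n$. Let $D_{I,J}\subset\overline{\mathscr{M}}_{0,24}$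 be the boundary divisor of the stable curves with a node that separates the marked points in $I$ from those in $J$. **Statement.** If a motion meets $D_{I,J}$, then $$\ell_{t_1s_1}+\ell_{t_2s_2}+\ell_{t_3s_3}+\ell_{t_4s_4}=0 .$$ -/

import Mathlib

open scoped Matrix LinearAlgebra.Projectivization

noncomputable section

/-! ### The moduli space of stable rational curves with marked points

`M̄_{0,ι}` is realised as the closure of `M_{0,ι}` in the product of projective lines (one factor for
each quadruple of distinct marked points) in which it is embedded by all cross-ratios. The
coordinate of a quadruple is the forgetful map to `M̄_{0,4} = ℙ¹`. -/

/-- The complex projective line. -/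
abbrev ProjLine : Type := ℙ ℂ (Fin 2 → ℂ)

/-- The bracket (the determinant) of two vectors of `ℂ²`. -/
def bracket (a b : Fin 2 → ℂ) : ℂ := a 0 * b 1 - a 1 * b 0

theorem bracket_rep_ne_zero {a b : ProjLine} (h : a ≠ b) : bracket a.rep b.rep ≠ 0 := by
  intro h0
  apply h
  have ha := a.rep_nonzero
  have hb := b.rep_nonzero
  rw [← a.mk_rep, ← b.mk_rep, Projectivization.mk_eq_mk_iff']
  unfold bracket at h0
  generalize a.rep = v at *
  generalize b.rep = w at *
  by_cases hw : w 0 = 0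
  · have hw1 : w 1 ≠ 0 := by
      intro hw1
      exact hb (by ext k; fin_cases k <;> simp [hw, hw1])
    have hv : v 0 = 0 := by simpa [hw, hw1] using h0
    refine ⟨v 1 / w 1, ?_⟩
    ext k
    fin_cases k <;> simp [hw, hv, hw1]
  · refine ⟨v 0 / w 0, ?_⟩
    ext k
    fin_cases k
    · simp [hw]
    · simp only [Fin.mk_one, Pi.smul_apply, smul_eq_mul]
      field_simp
      linear_combination h0

/-- The cross-ratio of the points `a, b, c, d`, as a point
`[(a - c)(b - d) : (a - d)(b - c)]` of the projective line. It is `[1 : 1]`, `[0 : 1]`, `[1 : 0]` when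
the points come together in the pairs `ab|cd`, `ac|bd`, `ad|bc`, respectively. -/
def crossRatio (P : Fin 4 ↪ ProjLine) : ProjLine :=
  Projectivization.mk ℂ
    ![bracket (P 0).rep (P 2).rep * bracket (P 1).rep (P 3).rep,
      bracket (P 0).rep (P 3).rep * bracket (P 1).rep (P 2).rep] (by
    have h02 := bracket_rep_ne_zero (P.injective.ne (show (0 : Fin 4) ≠ 2 by decide))
    have h13 := bracket_rep_ne_zero (P.injective.ne (show (1 : Fin 4) ≠ 3 by decide))
    intro h
    have h0 := congrFun h 0
    simp [h02, h13] at h0)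

/-- The product of projective lines indexed by the quadruples of distinct marked points. -/
def QuadrupleSpace (ι : Type) : Type := (Fin 4 ↪ ι) → ProjLine

/-- The Zariski topology of the product of projective lines: a basis of open sets is given by the
sets on which a multihomogeneous polynomial does not vanish. -/
instance (ι : Type) : TopologicalSpace (QuadrupleSpace ι) :=
  TopologicalSpace.generateFrom
    {U | ∃ (F : MvPolynomial ((Fin 4 ↪ ι) × Fin 2) ℂ) (deg : (Fin 4 ↪ ι) →₀ ℕ),
      F.IsWeightedHomogeneous (fun c => Finsupp.single c.1 1) deg ∧
      U = {x | MvPolynomial.eval (fun c => (x c.1).rep c.2) F ≠ 0}}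

/-- The point of the moduli space given by pairwise distinct points of the projective line. -/
def moduliPoint {ι : Type} (P : ι ↪ ProjLine) : QuadrupleSpace ι := fun c => crossRatio (c.trans P)

/-- `M_{0,ι}`: pairwise distinct points of the projective line, up to projective equivalence. -/
def openModuli (ι : Type) : Set (QuadrupleSpace ι) := Set.range moduliPoint

/-- `M̄_{0,ι}`. -/
def stableModuli (ι : Type) : Set (QuadrupleSpace ι) := closure (openModuli ι)

/-- The boundary divisor `D_{I,J}` of `M̄_{0,ι}`, where `J` is the complement of `I`: the stable curves
with a node that separates the marked points in `I` from those in `J`. That is, after forgetting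
all marked points but two in `I` and two in `J`, one always gets the singular curve on which the
former two are separated from the latter two. -/
def boundaryDivisor {ι : Type} (I : Set ι) : Set (QuadrupleSpace ι) :=
  {x | x ∈ stableModuli ι ∧ ∀ c : Fin 4 ↪ ι, c 0 ∈ I → c 1 ∈ I → c 2 ∈ Iᶜ → c 3 ∈ Iᶜ →
    x c = Projectivization.mk ℂ ![1, 1] (by simp)}

/-! ### Points of the complex sphere and their lifts -/

/-- The parametrisation of the conic at infinity `X² + Y² + Z² = 0` by the projective line. -/
def conicPoint (v : Fin 2 → ℂ) : Fin 3 → ℂ :=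
  ![v 0 ^ 2 - v 1 ^ 2, Complex.I * (v 0 ^ 2 + v 1 ^ 2), 2 * v 0 * v 1]

/-- The two lines through a point `q` of the complex sphere that lie on the sphere have the
directions `n` with `⟨n, n⟩ = ⟨q, n⟩ = 0`. They are told apart by `q × n = i n` and `q × n = -i n`; the
points at infinity of the former line and of the latter are the left lift and the right lift. -/
def IsLeftLift (q : Fin 3 → ℂ) (P : ProjLine) : Prop :=
  crossProduct q (conicPoint P.rep) = Complex.I • conicPoint P.rep

/-- See `IsLeftLift`. -/
def IsRightLift (q : Fin 3 → ℂ) (P : ProjLine) : Prop :=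
  crossProduct q (conicPoint P.rep) = -Complex.I • conicPoint P.rep

/-! ### The octahedron -/

/-- The graph of the octahedron. Its vertices `1, …, 6` are written as residues modulo `6`, so that
`6` is the element `0` of `Fin 6`. The non-edges are `{1,2}`, `{3,4}` and `{5,6}`. -/
def octahedron : SimpleGraph (Fin 6) :=
  (SimpleGraph.fromEdgeSet {s(1, 2), s(3, 4), s(5, 6)})ᶜ

/-- The fixed orientation of the edges of the octahedron. It makes each of the three quadrilaterals
into an oriented cycle. -/
def arcs : Finset (Fin 6 × Fin 6) :=
  {(1, 6), (1, 3), (4, 1), (5, 1), (6, 3), (4, 6), (6, 2), (3, 5), (3, 2), (5, 4), (2, 4), (2, 5)}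

/-- The edge `{i, j}`. -/
def octEdge {i j : Fin 6} (h : octahedron.Adj i j) : octahedron.edgeSet := ⟨s(i, j), h⟩

/-- The signed length `ℓ_{ij}` of an oriented edge `(i, j)`: it is the length of `{i, j}` if `(i, j)`
belongs to the fixed orientation, and minus this length otherwise. -/
def signedLength (len : octahedron.edgeSet → ℝ) {i j : Fin 6} (h : octahedron.Adj i j) : ℝ :=
  if (i, j) ∈ arcs then len (octEdge h) else -len (octEdge h)

/-- The labeling induced on the graph whose vertices are the edges of the octahedron, and where two
vertices are adjacent when they belong to the same face: the label of `{i, j}` and `{m, j}` is the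
value of `⟨q_{ij}, q_{mj}⟩` that the law of cosines in the face `{i, j, m}` yields for the unit vectors
given by `ρ i - ρ j = ℓ_{ij} q_{ij}`. -/
def inducedLabel (len : octahedron.edgeSet → ℝ) {i j m : Fin 6} (hij : octahedron.Adj i j)
    (hmj : octahedron.Adj m j) (him : octahedron.Adj i m) : ℝ :=
  (len (octEdge hij) ^ 2 + len (octEdge hmj) ^ 2 - len (octEdge him) ^ 2) /
    (2 * signedLength len hij * signedLength len hmj)

/-- The realizations on the complex sphere of the graph whose vertices are the edges of the
octahedron that are compatible with the induced labeling. -/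
def IsCompatible (len : octahedron.edgeSet → ℝ) (q : octahedron.edgeSet → Fin 3 → ℂ) : Prop :=
  (∀ e, q e ⬝ᵥ q e = 1) ∧
  ∀ (i j m : Fin 6) (hij : octahedron.Adj i j) (hmj : octahedron.Adj m j)
    (him : octahedron.Adj i m),
    q (octEdge hij) ⬝ᵥ q (octEdge hmj) = (inducedLabel len hij hmj him : ℂ)

/-- The marked points `P_{ij}` are indexed by the 24 oriented edges `(i, j)`. For `(i, j)` in the
fixed orientation, `P_{ij}` is the left lift and `P_{ji}` the right lift of `q_{ij}`. -/
def IsLift (q : octahedron.edgeSet → Fin 3 → ℂ) (P : octahedron.Dart ↪ ProjLine) : Prop :=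
  ∀ d : octahedron.Dart,
    if d.toProd ∈ arcs then IsLeftLift (q (octEdge d.adj)) (P d)
    else IsRightLift (q (octEdge d.adj)) (P d)

/-- The configuration space in `M̄_{0,24}`: the closure of the set of the points of `M_{0,24}` that are
given by the lifts of a compatible realization. -/
def configurationSpace (len : octahedron.edgeSet → ℝ) : Set (QuadrupleSpace octahedron.Dart) :=
  closure {x | ∃ q P, IsCompatible len q ∧ IsLift q P ∧ x = moduliPoint P}

/-- The motions: the irreducible components of the configuration space that meet `M_{0,24}`. -/
def IsMotion (len : octahedron.edgeSet → ℝ) (K : Set (QuadrupleSpace octahedron.Dart)) : Prop :=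
  Maximal (fun s => IsIrreducible s ∧ s ⊆ configurationSpace len) K ∧
    (K ∩ openModuli octahedron.Dart).Nonempty

/-- An oriented quadrilateral: the four edges of the quadrilateral induced by the neighbours of the
vertex `m`, each with an orientation `(t_k, s_k)`. -/
structure OrientedQuadrilateral (m : Fin 6) where
  /-- The oriented edge `(t_k, s_k)`. -/
  dart : Fin 4 → octahedron.Dart
  adj_fst : ∀ k, octahedron.Adj m (dart k).fst
  adj_snd : ∀ k, octahedron.Adj m (dart k).snd
  edge_injective : Function.Injective fun k => (dart k).edge

/-- The part `I` of the partition `(I, J)` of the marked points given by an oriented quadrilateral: it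
consists of all `P_{m∗}` and `P_{∗m}` and of the four points `P_{t_k s_k}`. Its complement `J` consists
of all `P_{n∗}` and `P_{∗n}`, where `n` is the vertex opposite to `m`, and of the `P_{s_k t_k}`. -/
def OrientedQuadrilateral.part {m : Fin 6} (Q : OrientedQuadrilateral m) :
    Set octahedron.Dart :=
  {d | d.fst = m ∨ d.snd = m} ∪ Set.range Q.dart

end

/-! The proof finds a relation between cross-ratios of the marked points that holds on the
configuration space and evaluates it on the divisor. The edge vectors `ℓ q` of a face add up to zero
(`edgeVector_face`): their sum is orthogonal to all three, so if it were nonzero, its isotropic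
direction would give a common lift of two edges. Hence the quadrilateral closes up: `∑ λ_k q_k = 0`
for the lengths `λ_k` (`sum_quadrilateral`).

Fix marked points `e` in `I` and `f` in `J` and pair this sum with `polar e f`. A point of the
sphere is proportional to the polar vector of its lifts `d_k`, `d_k'`, so the `k`-th term equals `[e
f] ℓ_k (1 - 2 B_k / A_k)`, where `[A_k : B_k]` is the cross-ratio of `d_k, e, d_k', f`
(`signedLength_mul_crossRatio`). Clearing denominators in `∑ ℓ_k (1 - 2 B_k / A_k) = 0` gives a
multihomogeneous equation, which persists on the Zariski closure. On `D_{I,J}` the pairs `d_k, e`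
and `d_k', f` are separated, so `A_k = B_k` and the equation reads `-∑ ℓ_k = 0`. -/

noncomputable section

/-! ### Cross products and isotropic vectors -/

open Matrix in
theorem triple_cross_left (u v w : Fin 3 → ℂ) :
    crossProduct u (crossProduct v w) = (u ⬝ᵥ w) • v - (u ⬝ᵥ v) • w := by
  simp only [cross_apply, vec3_dotProduct]
  ext k
  fin_cases k <;> simp <;> ring

open Matrix in
theorem triple_cross_right (u v w : Fin 3 → ℂ) :
    crossProduct (crossProduct u v) w = (u ⬝ᵥ w) • v - (v ⬝ᵥ w) • u := by
  simp only [cross_apply, vec3_dotProduct]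
  ext k
  fin_cases k <;> simp <;> ring

theorem dotProduct_crossProduct_comm (q v w : Fin 3 → ℂ) :
    crossProduct q v ⬝ᵥ w = -(v ⬝ᵥ crossProduct q w) := by
  simp only [cross_apply, Matrix.vec3_dotProduct]
  simp
  ring

/-- Eigenvectors of `q ×` with nonzero eigenvalue are orthogonal to `q`. -/
theorem dotProduct_eq_zero_of_cross {q w : Fin 3 → ℂ} {c : ℂ} (hc : c ≠ 0)
    (h : crossProduct q w = c • w) : q ⬝ᵥ w = 0 := by
  have h1 : q ⬝ᵥ crossProduct q w = 0 := dot_self_cross q w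
  rw [h, dotProduct_smul, smul_eq_mul] at h1
  exact (mul_eq_zero.mp h1).resolve_left hc

/-- Since `q ×` is skew, `c (v ⬝ w) = -c (v ⬝ w)`. With `v = w`, such eigenvectors are isotropic. -/
theorem eigenvectors_dotProduct_eq_zero {q v w : Fin 3 → ℂ} {c : ℂ} (hc : c ≠ 0)
    (hv : crossProduct q v = c • v) (hw : crossProduct q w = c • w) : v ⬝ᵥ w = 0 := by
  have h := dotProduct_crossProduct_comm q v w
  rw [hv, hw, smul_dotProduct, dotProduct_smul, smul_eq_mul] at h
  have : (2 * c) * (v ⬝ᵥ w) = 0 := by linear_combination h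
  exact (mul_eq_zero.mp this).resolve_left (by simpa using hc)

/-- The eigenspaces of `q ×` with nonzero eigenvalue are lines. -/
theorem eigenvectors_cross_eq_zero {q v w : Fin 3 → ℂ} {c : ℂ} (hc : c ≠ 0)
    (hv : crossProduct q v = c • v) (hw : crossProduct q w = c • w) : crossProduct v w = 0 := by
  have h := triple_cross_right q v w
  rw [dotProduct_eq_zero_of_cross hc hw, eigenvectors_dotProduct_eq_zero hc hv hw, hv,
    map_smul, LinearMap.smul_apply] at h
  simpa [hc] using h

/-- An isotropic vector orthogonal to a point `q` of the sphere is an eigenvector of `q ×`. -/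
theorem isotropic_eigenvector {q w : Fin 3 → ℂ} (hq : q ⬝ᵥ q = 1) (hqw : q ⬝ᵥ w = 0)
    (hw : w ⬝ᵥ w = 0) (hw0 : w ≠ 0) :
    crossProduct q w = Complex.I • w ∨ crossProduct q w = -Complex.I • w := by
  have h1 := triple_cross_left w q w
  rw [hw, dotProduct_comm w q, hqw] at h1
  -- By `h1`, `w × (q × w) = 0`, so `q × w` is parallel to `w`; the factor is read off at a nonzero
  -- coordinate of `w`.
  obtain ⟨c, hc⟩ : ∃ c : ℂ, crossProduct q w = c • w := by
    have h2 : crossProduct w (crossProduct q w) = 0 := by simpa using h1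
    generalize crossProduct q w = u at h2
    simp only [cross_apply] at h2
    have e0 := congrFun h2 0
    have e1 := congrFun h2 1
    have e2 := congrFun h2 2
    simp at e0 e1 e2
    by_cases w0 : w 0 = 0
    · by_cases w1 : w 1 = 0
      · have w2 : w 2 ≠ 0 := fun w2 => hw0 (by ext k; fin_cases k <;> simp [w0, w1, w2])
        refine ⟨u 2 / w 2, ?_⟩
        ext k
        fin_cases k
        · simpa [w0, w2] using e1
        · simpa [w1, w2] using e0
        · simp [w2]
      · refine ⟨u 1 / w 1, ?_⟩
        ext k
        fin_cases k
        · simpa [w0, w1] using e2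
        · simp [w1]
        · simp; field_simp; linear_combination e0
    · refine ⟨u 0 / w 0, ?_⟩
      ext k
      fin_cases k
      · simp [w0]
      · simp; field_simp; linear_combination e2
      · simp; field_simp; linear_combination -e1
  -- On the orthogonal complement of `q`, applying `q ×` twice is `-1`; hence `c ^ 2 = -1`.
  have h3 := triple_cross_left q q w
  rw [hq, hqw, hc, map_smul, hc, smul_smul] at h3
  have h4 : (c * c + 1) • w = 0 := by rw [add_smul, h3]; simp
  have h5 : (c - Complex.I) * (c + Complex.I) = 0 := by
    have := (smul_eq_zero.mp h4).resolve_right hw0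
    linear_combination this - Complex.I_sq
  rcases mul_eq_zero.mp h5 with h | h
  · left; rw [hc, sub_eq_zero.mp h]
  · right; rw [hc, eq_neg_of_add_eq_zero_left h]

/-! ### The conic at infinity and the lifts -/

theorem conicPoint_dotProduct (a b : Fin 2 → ℂ) :
    conicPoint a ⬝ᵥ conicPoint b = -2 * bracket a b ^ 2 := by
  simp only [conicPoint, bracket, Matrix.vec3_dotProduct]
  simp
  linear_combination (a 0 ^ 2 + a 1 ^ 2) * (b 0 ^ 2 + b 1 ^ 2) * Complex.I_sq

/-- The point with homogeneous coordinates the polar form of `conicPoint`: the pole of the line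
through two points of the conic. -/
def polar (a b : Fin 2 → ℂ) : Fin 3 → ℂ :=
  ![a 0 * b 0 - a 1 * b 1, Complex.I * (a 0 * b 0 + a 1 * b 1), a 0 * b 1 + a 1 * b 0]

theorem conicPoint_cross (a b : Fin 2 → ℂ) :
    crossProduct (conicPoint a) (conicPoint b) = (2 * Complex.I * bracket a b) • polar a b := by
  simp only [conicPoint, bracket, polar, cross_apply]
  ext k
  fin_cases k
  · simp; ring
  · simp
    linear_combination -2 * (a 0 * b 1 - a 1 * b 0) * (a 0 * b 0 + a 1 * b 1) * Complex.I_sq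
  · simp; ring

theorem polar_dotProduct (a b e f : Fin 2 → ℂ) :
    polar a b ⬝ᵥ polar e f = -(bracket a e * bracket b f + bracket a f * bracket b e) := by
  simp only [polar, bracket, Matrix.vec3_dotProduct]
  simp
  linear_combination (a 0 * b 0 + a 1 * b 1) * (e 0 * f 0 + e 1 * f 1) * Complex.I_sq

/-- A point of the sphere in terms of its lifts. -/
theorem bracket_smul_eq_neg_polar {q : Fin 3 → ℂ} {L R : ProjLine} (hL : IsLeftLift q L)
    (hR : IsRightLift q R) (hne : L ≠ R) :
    bracket L.rep R.rep • q = -polar L.rep R.rep := by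
  have hb := bracket_rep_ne_zero hne
  -- Expand `(q × L) × R` in two ways: it is `i (L × R)`, a multiple of the polar vector, and also
  -- `-(L ⬝ R) q`, because `q ⬝ R = 0`.
  have h := triple_cross_right q (conicPoint L.rep) (conicPoint R.rep)
  rw [dotProduct_eq_zero_of_cross (neg_ne_zero.mpr Complex.I_ne_zero) hR, conicPoint_dotProduct,
    hL, map_smul, LinearMap.smul_apply, conicPoint_cross] at h
  ext k
  have hk := congrFun h k
  simp at hk
  refine mul_left_cancel₀ (mul_ne_zero two_ne_zero hb) ?_
  simp
  linear_combination -hk + 2 * bracket L.rep R.rep * polar L.rep R.rep k * Complex.I_sq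

theorem bracket_mul_dotProduct_polar {q : Fin 3 → ℂ} {L R : ProjLine} (hL : IsLeftLift q L)
    (hR : IsRightLift q R) (hne : L ≠ R) (e f : Fin 2 → ℂ) :
    bracket L.rep R.rep * (q ⬝ᵥ polar e f) =
      bracket L.rep e * bracket R.rep f + bracket L.rep f * bracket R.rep e := by
  rw [← smul_eq_mul, ← smul_dotProduct, bracket_smul_eq_neg_polar hL hR hne, neg_dotProduct,
    polar_dotProduct, neg_neg]

/-- Lifts of two points of the sphere that are parallel to a common isotropic vector agree. -/
theorem lift_eq_of_common_eigenvector {q q' w : Fin 3 → ℂ} {c c' : ℂ} {P P' : ProjLine}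
    (hc : c ≠ 0) (hc' : c' ≠ 0) (hw0 : w ≠ 0)
    (hw : crossProduct q w = c • w) (hw' : crossProduct q' w = c' • w)
    (hP : crossProduct q (conicPoint P.rep) = c • conicPoint P.rep)
    (hP' : crossProduct q' (conicPoint P'.rep) = c' • conicPoint P'.rep) : P = P' := by
  -- Here `P × w = 0` and `P' ⬝ w = 0`, which leaves `(P' ⬝ P) w = 0`, while `P' ⬝ P = -2 [P' P] ^
  -- 2`.
  have h := triple_cross_left (conicPoint P'.rep) (conicPoint P.rep) w
  rw [eigenvectors_cross_eq_zero hc hP hw, eigenvectors_dotProduct_eq_zero hc' hP' hw',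
    conicPoint_dotProduct] at h
  by_contra hne
  have hb := bracket_rep_ne_zero (Ne.symm hne)
  have : (-(-2 * bracket P'.rep P.rep ^ 2)) • w = 0 := by
    rw [neg_smul]; simpa using h.symm
  simp [hb, hw0] at this

/-! ### The combinatorics of the octahedron -/

theorem octahedron_adj_iff {i j : Fin 6} : octahedron.Adj i j ↔
    i ≠ j ∧ s(i, j) ≠ s(1, 2) ∧ s(i, j) ≠ s(3, 4) ∧ s(i, j) ≠ s(5, 6) := by
  simp only [octahedron, SimpleGraph.compl_adj, SimpleGraph.fromEdgeSet_adj, Set.mem_insert_iff,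
    Set.mem_singleton_iff]
  tauto

instance : DecidableRel octahedron.Adj := fun _ _ => decidable_of_iff' _ octahedron_adj_iff

theorem swap_mem_arcs_iff : ∀ {i j : Fin 6}, octahedron.Adj i j →
    ((j, i) ∈ arcs ↔ (i, j) ∉ arcs) := by
  decide

theorem exists_opposite : ∀ m : Fin 6, ∃ n, n ≠ m ∧ ¬ octahedron.Adj m n ∧
    (∃ a, octahedron.Adj m a) ∧ (∃ b, octahedron.Adj n b) := by
  decide

theorem card_neighbors : ∀ m : Fin 6,
    (Finset.univ.filter fun a => octahedron.Adj m a).card = 4 := by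
  decide

/-- The fixed orientation makes the quadrilateral of the neighbours of `m` into a cycle. -/
theorem arcs_unique_snd : ∀ m : Fin 6, ∀ a ∈ arcs, ∀ b ∈ arcs, octahedron.Adj m a.1 →
    octahedron.Adj m a.2 → octahedron.Adj m b.1 → octahedron.Adj m b.2 → a.2 = b.2 → a = b := by
  decide

theorem arcs_unique_fst : ∀ m : Fin 6, ∀ a ∈ arcs, ∀ b ∈ arcs, octahedron.Adj m a.1 →
    octahedron.Adj m a.2 → octahedron.Adj m b.1 → octahedron.Adj m b.2 → a.1 = b.1 → a = b := by
  decide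

theorem octEdge_symm {i j : Fin 6} (h : octahedron.Adj i j) : octEdge h.symm = octEdge h :=
  Subtype.ext Sym2.eq_swap

theorem signedLength_symm (len : octahedron.edgeSet → ℝ) {i j : Fin 6}
    (h : octahedron.Adj i j) : signedLength len h.symm = -signedLength len h := by
  unfold signedLength
  rw [octEdge_symm h]
  by_cases hm : (i, j) ∈ arcs <;> simp [swap_mem_arcs_iff h, hm]

theorem signedLength_sq (len : octahedron.edgeSet → ℝ) {i j : Fin 6} (h : octahedron.Adj i j) :
    signedLength len h ^ 2 = len (octEdge h) ^ 2 := by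
  unfold signedLength
  split_ifs <;> simp

theorem signedLength_ne_zero {len : octahedron.edgeSet → ℝ} (hlen : ∀ e, 0 < len e) {i j : Fin 6}
    (h : octahedron.Adj i j) : signedLength len h ≠ 0 := by
  unfold signedLength
  split_ifs
  · exact (hlen _).ne'
  · exact neg_ne_zero.mpr (hlen _).ne'

/-! ### The edge vectors of a compatible realization -/

/-- The vector `ρ i - ρ j = ℓ_{ij} q_{ij}`. -/
def edgeVector (len : octahedron.edgeSet → ℝ) (q : octahedron.edgeSet → Fin 3 → ℂ) {i j : Fin 6}
    (h : octahedron.Adj i j) : Fin 3 → ℂ :=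
  (signedLength len h : ℂ) • q (octEdge h)

section

variable {len : octahedron.edgeSet → ℝ} {q : octahedron.edgeSet → Fin 3 → ℂ}

theorem edgeVector_symm {i j : Fin 6} (h : octahedron.Adj i j) :
    edgeVector len q h.symm = -edgeVector len q h := by
  simp [edgeVector, signedLength_symm len h, octEdge_symm h]

theorem edgeVector_dotProduct_self (hq : IsCompatible len q) {i j : Fin 6}
    (h : octahedron.Adj i j) :
    edgeVector len q h ⬝ᵥ edgeVector len q h = (len (octEdge h) : ℂ) ^ 2 := by
  rw [edgeVector, smul_dotProduct, dotProduct_smul, hq.1, ← Complex.ofReal_pow, ← signedLength_sq]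
  simp [sq]

theorem edgeVector_dotProduct (hlen : ∀ e, 0 < len e) (hq : IsCompatible len q) {i j m : Fin 6}
    (hij : octahedron.Adj i j) (hmj : octahedron.Adj m j) (him : octahedron.Adj i m) :
    edgeVector len q hij ⬝ᵥ edgeVector len q hmj =
      ((len (octEdge hij) : ℂ) ^ 2 + len (octEdge hmj) ^ 2 - len (octEdge him) ^ 2) / 2 := by
  have h1 : (signedLength len hij : ℂ) ≠ 0 := by exact_mod_cast signedLength_ne_zero hlen hij
  have h2 : (signedLength len hmj : ℂ) ≠ 0 := by exact_mod_cast signedLength_ne_zero hlen hmj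
  rw [edgeVector, edgeVector, smul_dotProduct, dotProduct_smul, hq.2 i j m hij hmj him,
    inducedLabel]
  push_cast
  simp only [smul_eq_mul]
  field_simp

/-- Of an isotropic vector orthogonal to a point of the sphere, the point at infinity is one of the
lifts of the point. -/
theorem exists_lift_of_isotropic {P : octahedron.Dart ↪ ProjLine} (hq : IsCompatible len q)
    (hP : IsLift q P) {w : Fin 3 → ℂ} (hw : w ⬝ᵥ w = 0) (hw0 : w ≠ 0) {i j : Fin 6}
    (h : octahedron.Adj i j) (hqw : q (octEdge h) ⬝ᵥ w = 0) :
    ∃ (d : octahedron.Dart) (c : ℂ), d.edge = s(i, j) ∧ c ≠ 0 ∧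
      crossProduct (q (octEdge h)) w = c • w ∧
      crossProduct (q (octEdge h)) (conicPoint (P d).rep) = c • conicPoint (P d).rep := by
  have hI := Complex.I_ne_zero
  have h1 := hP ⟨(i, j), h⟩
  have h2 := hP ⟨(j, i), h.symm⟩
  simp only [swap_mem_arcs_iff h, octEdge_symm h] at h1 h2
  by_cases hm : (i, j) ∈ arcs <;>
    simp only [hm, if_true, if_false, not_true, not_false_eq_true] at h1 h2 <;>
    rcases isotropic_eigenvector (hq.1 _) hqw hw hw0 with h3 | h3
  · exact ⟨⟨(i, j), h⟩, _, rfl, hI, h3, h1⟩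
  · exact ⟨⟨(j, i), h.symm⟩, _, Sym2.eq_swap, neg_ne_zero.mpr hI, h3, h2⟩
  · exact ⟨⟨(j, i), h.symm⟩, _, Sym2.eq_swap, hI, h3, h2⟩
  · exact ⟨⟨(i, j), h⟩, _, rfl, neg_ne_zero.mpr hI, h3, h1⟩

/-- The edge vectors of a face add up to zero when the lifts are distinct. -/
theorem edgeVector_face {P : octahedron.Dart ↪ ProjLine} (hlen : ∀ e, 0 < len e)
    (hq : IsCompatible len q) (hP : IsLift q P) {i j m : Fin 6} (hij : octahedron.Adj i j)
    (hjm : octahedron.Adj j m) (hmi : octahedron.Adj m i) :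
    edgeVector len q hij + edgeVector len q hjm + edgeVector len q hmi = 0 := by
  have d1 := edgeVector_dotProduct hlen hq hij hjm.symm hmi.symm
  have d2 := edgeVector_dotProduct hlen hq hjm hmi.symm hij.symm
  have d3 := edgeVector_dotProduct hlen hq hmi hij.symm hjm.symm
  have s1 := edgeVector_dotProduct_self hq hij
  have s2 := edgeVector_dotProduct_self hq hjm
  have s3 := edgeVector_dotProduct_self hq hmi
  simp only [edgeVector_symm hij, edgeVector_symm hjm, edgeVector_symm hmi, octEdge_symm hij,
    octEdge_symm hjm, octEdge_symm hmi, dotProduct_neg] at d1 d2 d3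
  by_contra hw0
  set u := edgeVector len q hij
  set v := edgeVector len q hjm
  set x := edgeVector len q hmi
  have c1 := dotProduct_comm u v
  have c2 := dotProduct_comm v x
  have c3 := dotProduct_comm x u
  -- The law of cosines makes the sum orthogonal to each of its summands, hence isotropic.
  have hw1 : u ⬝ᵥ (u + v + x) = 0 := by
    simp only [dotProduct_add]; linear_combination s1 - d1 - d3 - c3
  have hw2 : v ⬝ᵥ (u + v + x) = 0 := by
    simp only [dotProduct_add]; linear_combination s2 - d1 - d2 - c1
  have hw3 : x ⬝ᵥ (u + v + x) = 0 := by
    simp only [dotProduct_add]; linear_combination s3 - d2 - d3 - c2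
  have hw : (u + v + x) ⬝ᵥ (u + v + x) = 0 := by
    rw [add_dotProduct, add_dotProduct, hw1, hw2, hw3]; simp
  have hn1 : (signedLength len hij : ℂ) ≠ 0 := by exact_mod_cast signedLength_ne_zero hlen hij
  have hn2 : (signedLength len hjm : ℂ) ≠ 0 := by exact_mod_cast signedLength_ne_zero hlen hjm
  have hq1 : q (octEdge hij) ⬝ᵥ (u + v + x) = 0 := by
    refine (mul_eq_zero.mp ?_).resolve_left hn1
    rwa [← smul_eq_mul, ← smul_dotProduct]
  have hq2 : q (octEdge hjm) ⬝ᵥ (u + v + x) = 0 := by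
    refine (mul_eq_zero.mp ?_).resolve_left hn2
    rwa [← smul_eq_mul, ← smul_dotProduct]
  obtain ⟨d, c, hd, hc, hcw, hcP⟩ := exists_lift_of_isotropic hq hP hw hw0 hij hq1
  obtain ⟨d', c', hd', hc', hcw', hcP'⟩ := exists_lift_of_isotropic hq hP hw hw0 hjm hq2
  -- The direction of the sum is a lift of two different edges of the face, against the distinctness
  -- of the marked points.
  have := P.injective (lift_eq_of_common_eigenvector hc hc' hw0 hcw hcw' hcP hcP')
  rw [← this, hd] at hd'
  have hmi' := hmi.ne
  have hij' := hij.ne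
  rcases Sym2.eq_iff.mp hd' with ⟨h, _⟩ | ⟨h, _⟩
  · exact hij' h
  · exact hmi' h.symm

end

/-! ### Closing of the quadrilaterals -/

/-- The edge of a quadrilateral with the fixed orientation. -/
theorem exists_arc (d : octahedron.Dart) : ∃ a : octahedron.Dart, a.toProd ∈ arcs ∧
    (a = d ∨ a = d.symm) := by
  by_cases h : d.toProd ∈ arcs
  · exact ⟨d, h, Or.inl rfl⟩
  · exact ⟨d.symm, (swap_mem_arcs_iff d.adj).mpr h, Or.inr rfl⟩

/-- Since `m` has exactly four neighbours, `f` enumerates them, and the sum does not depend on `f`.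
This lets the heads and the tails of the quadrilateral cancel. -/
theorem sum_eq_sum_neighbors {m : Fin 6} (f : Fin 4 → Fin 6) (hf : Function.Injective f)
    (hadj : ∀ k, octahedron.Adj m (f k)) (g : ∀ a, octahedron.Adj m a → Fin 3 → ℂ) :
    ∑ k, g (f k) (hadj k) =
      ∑ a ∈ Finset.univ.filter (fun a => octahedron.Adj m a),
        if h : octahedron.Adj m a then g a h else 0 := by
  have himg : Finset.univ.image f = Finset.univ.filter (fun a => octahedron.Adj m a) := by
    apply Finset.eq_of_subset_of_card_le
    · intro a ha
      obtain ⟨k, _, rfl⟩ := Finset.mem_image.mp ha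
      simpa using hadj k
    · rw [card_neighbors, Finset.card_image_of_injective _ hf]; simp
  rw [← himg, Finset.sum_image hf.injOn]
  exact Finset.sum_congr rfl fun k _ => by rw [dif_pos (hadj k)]

/-- The quadrilateral of the neighbours of a vertex closes up. -/
theorem sum_quadrilateral {len : octahedron.edgeSet → ℝ} {q : octahedron.edgeSet → Fin 3 → ℂ}
    {P : octahedron.Dart ↪ ProjLine} (hlen : ∀ e, 0 < len e) (hq : IsCompatible len q)
    (hP : IsLift q P) {m : Fin 6} (Q : OrientedQuadrilateral m) :
    ∑ k, (len (octEdge (Q.dart k).adj) : ℂ) • q (octEdge (Q.dart k).adj) = 0 := by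
  choose a ha had using fun k => exists_arc (Q.dart k)
  have hfst : ∀ k, octahedron.Adj m (a k).fst := fun k => by
    rcases had k with h | h <;> rw [h]
    exacts [Q.adj_fst k, Q.adj_snd k]
  have hsnd : ∀ k, octahedron.Adj m (a k).snd := fun k => by
    rcases had k with h | h <;> rw [h]
    exacts [Q.adj_snd k, Q.adj_fst k]
  have hinj : ∀ k l, (a k).toProd = (a l).toProd → k = l := fun k l h => by
    have hedge : ∀ k, (a k).edge = (Q.dart k).edge := fun k => by
      rcases had k with h | h <;> simp [h]
    refine Q.edge_injective ?_
    change (Q.dart k).edge = (Q.dart l).edge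
    rw [← hedge, ← hedge, SimpleGraph.Dart.ext _ _ h]
  -- The face spanned by the edge and `m` writes the edge vector as `(ρ m - ρ s) - (ρ m - ρ t)`,
  -- with `(t, s)` in the fixed orientation.
  have hterm : ∀ k, (len (octEdge (Q.dart k).adj) : ℂ) • q (octEdge (Q.dart k).adj) =
      edgeVector len q (hsnd k) - edgeVector len q (hfst k) := fun k => by
    have h1 := edgeVector_face hlen hq hP (a k).adj (hsnd k).symm (hfst k)
    have h2 : edgeVector len q (a k).adj =
        (len (octEdge (Q.dart k).adj) : ℂ) • q (octEdge (Q.dart k).adj) := by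
      have h3 : octEdge (a k).adj = octEdge (Q.dart k).adj := by
        rcases had k with h | h
        · rw [h]
        · exact Subtype.ext (by
            change (a k).edge = (Q.dart k).edge
            rw [h, SimpleGraph.Dart.edge_symm])
      have h4 : signedLength len (a k).adj = len (octEdge (Q.dart k).adj) := by
        rw [← h3]
        exact if_pos (ha k)
      rw [edgeVector, h3, h4]
    rw [← h2]
    rw [edgeVector_symm (hsnd k)] at h1
    linear_combination (exp := 1) h1
  rw [Finset.sum_congr rfl fun k _ => hterm k, Finset.sum_sub_distrib,
    sum_eq_sum_neighbors (fun k => (a k).snd) (fun k l h => hinj k l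
      (arcs_unique_snd m _ (ha k) _ (ha l) (hfst k) (hsnd k) (hfst l) (hsnd l) h)) hsnd
      (fun _ h => edgeVector len q h),
    sum_eq_sum_neighbors (fun k => (a k).fst) (fun k l h => hinj k l
      (arcs_unique_fst m _ (ha k) _ (ha l) (hfst k) (hsnd k) (hfst l) (hsnd l) h)) hfst
      (fun _ h => edgeVector len q h), sub_self]

/-! ### The equation of the configuration space -/

/-- The quadruple formed by `d`, `e`, the reversal of `d`, and `f`. -/
def reversalQuadruple (d e f : octahedron.Dart) (hde : d ≠ e) (hdf : d ≠ f) (hse : d.symm ≠ e)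
    (hsf : d.symm ≠ f) (hef : e ≠ f) : Fin 4 ↪ octahedron.Dart :=
  ⟨![d, e, d.symm, f], by
    have hd := d.symm_ne
    intro x y h
    fin_cases x <;> fin_cases y <;> simp at h ⊢ <;>
      first | exact absurd h ‹_› | exact absurd h.symm ‹_›⟩

/-- The multihomogeneous polynomial `∑ k, ℓ k (A k - 2 B k) ∏_{l ≠ k} A l` in the homogeneous
coordinates `[A k : B k]` of the factors `c k` of the product of projective lines. -/
def lengthPolynomial {ι : Type} (l : Fin 4 → ℂ) (c : Fin 4 → (Fin 4 ↪ ι)) :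
    MvPolynomial ((Fin 4 ↪ ι) × Fin 2) ℂ :=
  ∑ k, MvPolynomial.C (l k) *
    ((MvPolynomial.X (c k, 0) - MvPolynomial.C 2 * MvPolynomial.X (c k, 1)) *
      ∏ j ∈ Finset.univ.erase k, MvPolynomial.X (c j, 0))

theorem lengthPolynomial_isWeightedHomogeneous {ι : Type} (l : Fin 4 → ℂ)
    (c : Fin 4 → (Fin 4 ↪ ι)) :
    (lengthPolynomial l c).IsWeightedHomogeneous
      (fun c => (Finsupp.single c.1 1 : (Fin 4 ↪ ι) →₀ ℕ)) (∑ k, Finsupp.single (c k) 1) := by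
  refine MvPolynomial.IsWeightedHomogeneous.sum _ _ _ fun k _ => ?_
  rw [← zero_add (∑ k, Finsupp.single (c k) 1), ← Finset.add_sum_erase _ _ (Finset.mem_univ k)]
  refine (MvPolynomial.isWeightedHomogeneous_C _ _).mul (.mul ?_ ?_)
  · refine Submodule.sub_mem (MvPolynomial.weightedHomogeneousSubmodule ℂ _ _)
      (MvPolynomial.isWeightedHomogeneous_X _ _ _) ?_
    have := (MvPolynomial.isWeightedHomogeneous_C (σ := (Fin 4 ↪ ι) × Fin 2)
      (fun c => (Finsupp.single c.1 1 : (Fin 4 ↪ ι) →₀ ℕ)) (2 : ℂ)).mul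
      (MvPolynomial.isWeightedHomogeneous_X ℂ _ (c k, 1))
    rwa [zero_add] at this
  · exact MvPolynomial.IsWeightedHomogeneous.prod _ _ _ fun j _ =>
      MvPolynomial.isWeightedHomogeneous_X ℂ _ _

theorem eval_lengthPolynomial {ι : Type} (l : Fin 4 → ℂ) (c : Fin 4 → (Fin 4 ↪ ι))
    (x : (Fin 4 ↪ ι) × Fin 2 → ℂ) : MvPolynomial.eval x (lengthPolynomial l c) =
      ∑ k, l k * ((x (c k, 0) - 2 * x (c k, 1)) * ∏ j ∈ Finset.univ.erase k, x (c j, 0)) := by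
  simp [lengthPolynomial, map_sum, map_prod]

theorem isClosed_lengthPolynomial {ι : Type} (l : Fin 4 → ℂ) (c : Fin 4 → (Fin 4 ↪ ι)) :
    IsClosed {x : QuadrupleSpace ι |
      MvPolynomial.eval (fun c => (x c.1).rep c.2) (lengthPolynomial l c) = 0} := by
  rw [← isOpen_compl_iff]
  exact TopologicalSpace.isOpen_generateFrom_of_mem
    ⟨_, _, lengthPolynomial_isWeightedHomogeneous l c, rfl⟩

/-! ### The equation at the lifts and on the divisor -/

theorem exists_rep_crossRatio (P : Fin 4 ↪ ProjLine) : ∃ r : ℂ, (crossRatio P).rep =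
    r • ![bracket (P 0).rep (P 2).rep * bracket (P 1).rep (P 3).rep,
      bracket (P 0).rep (P 3).rep * bracket (P 1).rep (P 2).rep] := by
  obtain ⟨r, hr⟩ := Projectivization.exists_smul_eq_mk_rep ℂ _ (fun h => by
    have h02 := bracket_rep_ne_zero (P.injective.ne (show (0 : Fin 4) ≠ 2 by decide))
    have h13 := bracket_rep_ne_zero (P.injective.ne (show (1 : Fin 4) ≠ 3 by decide))
    have h0 := congrFun h 0
    simp [h02, h13] at h0 :
    ![bracket (P 0).rep (P 2).rep * bracket (P 1).rep (P 3).rep,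
      bracket (P 0).rep (P 3).rep * bracket (P 1).rep (P 2).rep] ≠ 0)
  exact ⟨r, hr.symm⟩

/-- The dot product with `polar e f` of the point with lifts `P d` and `P d.symm`, in the coordinates
of the cross-ratio. -/
theorem signedLength_mul_crossRatio {len : octahedron.edgeSet → ℝ}
    {q : octahedron.edgeSet → Fin 3 → ℂ} {P : octahedron.Dart ↪ ProjLine} (hP : IsLift q P)
    (d : octahedron.Dart) (e f : Fin 2 → ℂ) :
    (signedLength len d.adj : ℂ) * (bracket (P d).rep (P d.symm).rep * bracket e f -
        2 * (bracket (P d).rep f * bracket e (P d.symm).rep)) =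
      bracket (P d).rep (P d.symm).rep *
        ((len (octEdge d.adj) : ℂ) • q (octEdge d.adj) ⬝ᵥ polar e f) := by
  have hne : P d ≠ P d.symm := P.injective.ne d.symm_ne.symm
  have h1 := hP d
  have h2 := hP d.symm
  have hs : octEdge d.symm.adj = octEdge d.adj := octEdge_symm d.adj
  have hm : d.symm.toProd ∈ arcs ↔ d.toProd ∉ arcs := swap_mem_arcs_iff d.adj
  simp only [hs, hm] at h2
  rw [smul_dotProduct, smul_eq_mul]
  by_cases h : d.toProd ∈ arcs
  · simp only [h, not_true, if_true, if_false] at h1 h2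
    have key := bracket_mul_dotProduct_polar h1 h2 hne e f
    rw [show signedLength len d.adj = len (octEdge d.adj) from if_pos h]
    -- In coordinates, the Plücker relation `[d d'][e f] = [d e][d' f] - [d f][d' e]` is absorbed by
    -- ring normalisation.
    unfold bracket at *
    linear_combination -(len (octEdge d.adj) : ℂ) * key
  · simp only [h, not_false_eq_true, if_true, if_false] at h1 h2
    have key := bracket_mul_dotProduct_polar h2 h1 hne.symm e f
    -- Now `d` carries the right lift; the sign from exchanging the lifts in the bracket is the sign
    -- of `ℓ`.
    rw [show signedLength len d.adj = -len (octEdge d.adj) from if_neg h]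
    unfold bracket at *
    push_cast
    linear_combination (len (octEdge d.adj) : ℂ) * key

theorem eval_moduliPoint_eq_zero {len : octahedron.edgeSet → ℝ}
    {q : octahedron.edgeSet → Fin 3 → ℂ} {P : octahedron.Dart ↪ ProjLine} (hlen : ∀ e, 0 < len e)
    (hq : IsCompatible len q) (hP : IsLift q P) {m : Fin 6} (Q : OrientedQuadrilateral m)
    (c : Fin 4 → (Fin 4 ↪ octahedron.Dart)) (e f : octahedron.Dart)
    (hc : ∀ k, (c k : Fin 4 → octahedron.Dart) = ![Q.dart k, e, (Q.dart k).symm, f]) :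
    MvPolynomial.eval (fun c => (moduliPoint P c.1).rep c.2)
      (lengthPolynomial (fun k => (signedLength len (Q.dart k).adj : ℂ)) c) = 0 := by
  rw [eval_lengthPolynomial]
  set s := fun k => (len (octEdge (Q.dart k).adj) : ℂ) • q (octEdge (Q.dart k).adj) ⬝ᵥ
    polar (P e).rep (P f).rep
  set b := fun k => bracket (P (Q.dart k)).rep (P (Q.dart k).symm).rep
  set t := bracket (P e).rep (P f).rep
  have hsum : ∑ k, s k = 0 := by
    rw [← sum_dotProduct, sum_quadrilateral hlen hq hP Q, zero_dotProduct]
  have hrep : ∀ k, ∃ r : ℂ, (moduliPoint P (c k)).rep 0 = r * b k * t ∧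
      (signedLength len (Q.dart k).adj : ℂ) *
        ((moduliPoint P (c k)).rep 0 - 2 * (moduliPoint P (c k)).rep 1) = r * b k * s k := by
    intro k
    obtain ⟨r, hr⟩ := exists_rep_crossRatio ((c k).trans P)
    have key := signedLength_mul_crossRatio (len := len) hP (Q.dart k) (P e).rep (P f).rep
    refine ⟨r, ?_, ?_⟩ <;> unfold moduliPoint <;> rw [hr] <;> simp [hc k]
    · ring
    · linear_combination r * key
  choose r hA hB using hrep
  -- The factor `r k * b k` completes the product over `j ≠ k`, so the coefficient of `s k` is the
  -- same for all `k`.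
  calc _ = ∑ k, (∏ j, r j * b j) * t ^ 3 * s k := by
        refine Finset.sum_congr rfl fun k _ => ?_
        rw [← mul_assoc, hB, Finset.prod_congr rfl fun j _ => hA j, Finset.prod_mul_distrib,
          Finset.prod_const, Finset.card_erase_of_mem (Finset.mem_univ k),
          ← Finset.mul_prod_erase Finset.univ (fun j => r j * b j) (Finset.mem_univ k)]
        simp only [Finset.card_univ, Fintype.card_fin]
        ring
    _ = 0 := by rw [← Finset.mul_sum, hsum, mul_zero]

/-- With all homogeneous coordinates equal to a common `r ≠ 0`, the `k`-th summand is `-l k * r ^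
4`. -/
theorem sum_eq_zero_of_mk_one_one {ι : Type} {l : Fin 4 → ℂ} {c : Fin 4 → (Fin 4 ↪ ι)}
    {x : QuadrupleSpace ι} (hx : ∀ k, x (c k) = Projectivization.mk ℂ ![1, 1] (by simp))
    (h : MvPolynomial.eval (fun c => (x c.1).rep c.2) (lengthPolynomial l c) = 0) :
    ∑ k, l k = 0 := by
  obtain ⟨r, hr⟩ := Projectivization.exists_smul_eq_mk_rep ℂ (![1, 1] : Fin 2 → ℂ) (by simp)
  have hr0 : (r : ℂ) ≠ 0 := r.ne_zero
  have e0 : ∀ k, (x (c k)).rep 0 = r := fun k => by rw [hx, ← hr]; simp [Units.smul_def]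
  have e1 : ∀ k, (x (c k)).rep 1 = r := fun k => by rw [hx, ← hr]; simp [Units.smul_def]
  rw [eval_lengthPolynomial] at h
  simp only [e0, e1, Finset.prod_const, Finset.card_erase_of_mem (Finset.mem_univ _),
    ← Finset.sum_mul] at h
  refine (mul_eq_zero.mp h).resolve_right (mul_ne_zero ?_ (pow_ne_zero _ hr0))
  rw [show (r : ℂ) - 2 * r = -r by ring]
  exact neg_ne_zero.mpr hr0

end

theorem mainTheorem2 (len : octahedron.edgeSet → ℝ) (hlen : ∀ e, 0 < len e)
    (K : Set (QuadrupleSpace octahedron.Dart)) (hK : IsMotion len K)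
    (m : Fin 6) (Q : OrientedQuadrilateral m)
    (hmeet : (K ∩ boundaryDivisor Q.part).Nonempty) :
    ∑ k, signedLength len (Q.dart k).adj = 0 := by
  obtain ⟨x, hxK, -, hxD⟩ := hmeet
  obtain ⟨n, hnm, hmn, ⟨a, ha⟩, b, hb⟩ := exists_opposite m
  -- Auxiliary marked points, `e` in `I` and `f` in `J`, distinct from all points of the
  -- quadrilateral.
  let e : octahedron.Dart := ⟨(m, a), ha⟩
  let f : octahedron.Dart := ⟨(n, b), hb⟩
  have hbm : b ≠ m := fun h => hmn (h ▸ hb.symm)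
  have he : e ∈ Q.part := Or.inl (Or.inl rfl)
  have hd : ∀ k, Q.dart k ∈ Q.part := fun k => Or.inr ⟨k, rfl⟩
  have hf : f ∉ Q.part := by
    rintro ((h | h) | ⟨k, h⟩)
    · exact hnm h
    · exact hbm h
    · have := Q.adj_fst k
      rw [h] at this
      exact hmn this
  have hs : ∀ k, (Q.dart k).symm ∉ Q.part := by
    rintro k ((h | h) | ⟨k', h⟩)
    · exact (Q.adj_snd k).ne h.symm
    · exact (Q.adj_fst k).ne h.symm
    · have hk : k' = k := Q.edge_injective (by
        change (Q.dart k').edge = (Q.dart k).edge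
        rw [h, SimpleGraph.Dart.edge_symm])
      rw [hk] at h
      exact (Q.dart k).symm_ne h.symm
  have hde : ∀ k, Q.dart k ≠ e := fun k h => (Q.adj_fst k).ne (by rw [h])
  have hsf : ∀ k, (Q.dart k).symm ≠ f := fun k h => by
    have h1 : (Q.dart k).symm.fst = n := by rw [h]
    have h2 := Q.adj_snd k
    rw [show (Q.dart k).snd = n from h1] at h2
    exact hmn h2
  let c : Fin 4 → (Fin 4 ↪ octahedron.Dart) := fun k =>
    reversalQuadruple (Q.dart k) e f (hde k) (fun h => hf (h ▸ hd k))
      (fun h => hs k (h ▸ he)) (hsf k) (fun h => hf (h ▸ he))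
  -- The equation holds at all lifts of compatible realizations and is closed, so it holds at the
  -- boundary point `x`.
  have hx := closure_minimal (t := {x : QuadrupleSpace octahedron.Dart |
      MvPolynomial.eval (fun c => (x c.1).rep c.2)
        (lengthPolynomial (fun k => (signedLength len (Q.dart k).adj : ℂ)) c) = 0}) (by
      rintro _ ⟨q, P, hq, hP, rfl⟩
      exact eval_moduliPoint_eq_zero hlen hq hP Q c e f fun _ => rfl)
    (isClosed_lengthPolynomial _ _) (hK.1.1.2 hxK)
  have hsum := sum_eq_zero_of_mk_one_one (fun k => hxD (c k) (hd k) he (hs k) hf) hx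
  exact_mod_cast hsum
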